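/- Let $\mathbb K$ be a field of characteristic zero and let $n\ge 0$ be an integer. Let $M_n(\mathbb K)$ be the associative algebra of $n\times n$ matrices with product $q(x,y)=xy$, let $\mathfrak{gl}_n(\mathbb K)$ be the Lie algebra with the same underlying space and bracket $[x,y]=xy-yx$, and let $(M_n,q)$ be the same space regarded as a left pre-Lie algebra, i.e. as a space with a bilinear product satisfying $$q(x,q(y,z))-q(q(x,y),z)=q(y,q(x,z))-q(q(y,x),z).$$ A formal deformation of an associative (resp. Lie, left pre-Lie) product $q$ on a finite-dimensional space $V$ is $q_t=q+\sum_{k\ge1}t^kc_k$, with bilinear $c_k:V\times V\to V$, whose $\mathbb K[[t]]$-bilinear extension is an associative (resp. Lie, left pre-Lie) product on $V\otimes\mathbb K[[t]]=V[[t]]$. It is trivial if there is $\varphi_t=\mathrm{id}+\sum_{k\ge1}t^kb_k$, with linear $b_k:V\to V$, such that $q_t(\varphi_t(x),\varphi_t(y))=\varphi_t(q(x,y))$. The product $q$ is rigid if all its formal deformations (of the given kind) are trivial. It is infinitesimally rigid if its second cohomology group $H^2=Z^2/B^2$ with adjoint coefficients (Hochschild, resp. Chevalley, resp. pre-Lie)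 vanishes. In the pre-Lie case, $Z^2$ consists of the bilinear maps $c$ such that the expression $$x\,c(y,z)-c(xy,z)+c(x,yz)-c(x,y)z$$ is symmetric in $x,y$ (writing $xy$ for $q(x,y)$), and $B^2$ consists of the maps $(x,y)\mapsto x\,f(y)-f(xy)+f(x)y$ with $f:V\to V$ linear. A true deformation of $q$ at order $1$ is a formal deformation of the form $q+tc$ with $c\notin B^2$. Then: 1. The associative algebra $M_n(\mathbb K)$ is infinitesimally rigid and rigid. 2. The Lie algebra $\mathfrak{gl}_n(\mathbb K)$ is infinitesimally rigid and rigid. 3. If $n\ge2$, the left pre-Lie algebra $(M_n,q)$ admits true deformations at order $1$, its second pre-Lie cohomology group is non-zero, and it is not rigid. More precisely, for every non-scalar matrix $a$, the bilinear map $c_a(x,y)=\frac1n\operatorname{tr}(x)[y,a]$ is a pre-Lie $2$-cocycle and is not a $2$-coboundary, and $q+tc_a$ is a true deformation of $(M_n,q)$ at order $1$, which is a non-trivial formal deformation. -/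

import Mathlib

set_option maxSynthPendingDepth 3

attribute [local instance] LieRing.ofAssociativeRing

/-! ### Kinds of products -/

section Kinds

variable {W : Type*} [AddCommGroup W]

/-- The product `m` is associative. -/
def IsAssocProduct (m : W → W → W) : Prop :=
  ∀ x y z, m (m x y) z = m x (m y z)

/-- The product `m` is a Lie bracket: it is alternating and satisfies the Jacobi identity. -/
def IsLieBracket (m : W → W → W) : Prop :=
  (∀ x, m x x = 0) ∧ ∀ x y z, m x (m y z) + m y (m z x) + m z (m x y) = 0

/-- The product `m` is a left pre-Lie product. -/
def IsLeftPreLie (m : W → W → W) : Prop :=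
  ∀ x y z, m x (m y z) - m (m x y) z = m y (m x z) - m (m y x) z

end Kinds

/-! ### Formal deformations

For a finite dimensional `V`, the space `V ⊗ K[[t]]` is the space `V[[t]]` of formal power series
with coefficients in `V`. A series `∑ tᵏ uₖ` is represented by its coefficients `u : ℕ → V`. -/

section Deformation

variable {K V : Type*} [Field K] [AddCommGroup V] [Module K V]

/-- The `K[[t]]`-bilinear product `q_t = ∑ tᵏ cₖ` on `V[[t]]`: the coefficient of `t^N` in
`q_t (∑ tʲ uⱼ, ∑ tˡ vₗ)` is `∑_{k + j + l = N} cₖ (uⱼ, vₗ)`. -/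
def seriesMul (c : ℕ → V →ₗ[K] V →ₗ[K] V) (u v : ℕ → V) : ℕ → V := fun N =>
  ∑ p ∈ Finset.HasAntidiagonal.antidiagonal N, ∑ r ∈ Finset.HasAntidiagonal.antidiagonal p.2, c p.1 (u r.1) (v r.2)

/-- The `K[[t]]`-linear map `φ_t = ∑ tᵏ bₖ` on `V[[t]]`. -/
def seriesMap (b : ℕ → V →ₗ[K] V) (u : ℕ → V) : ℕ → V := fun N =>
  ∑ p ∈ Finset.HasAntidiagonal.antidiagonal N, b p.1 (u p.2)

/-- `q_t = q + t c₁ + t² c₂ + ⋯` is a formal deformation of `q`, among the products of kind `P`: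
the constant term is `q`, and `q_t` is a product of kind `P` on `V[[t]]`. -/
def IsFormalDeformation (P : ((ℕ → V) → (ℕ → V) → (ℕ → V)) → Prop)
    (q : V →ₗ[K] V →ₗ[K] V) (c : ℕ → V →ₗ[K] V →ₗ[K] V) : Prop :=
  c 0 = q ∧ P (seriesMul c)

/-- `q_t` is trivial: there is `φ_t = id + t b₁ + t² b₂ + ⋯` such that
`q_t (φ_t u, φ_t v) = φ_t (q (u, v))`, where `q` is extended `K[[t]]`-bilinearly. -/
def IsTrivialDeformation (q : V →ₗ[K] V →ₗ[K] V) (c : ℕ → V →ₗ[K] V →ₗ[K] V) : Prop :=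
  ∃ b : ℕ → V →ₗ[K] V, b 0 = LinearMap.id ∧
    ∀ u v : ℕ → V, seriesMul c (seriesMap b u) (seriesMap b v) =
      seriesMap b (seriesMul (fun k => if k = 0 then q else 0) u v)

/-- `q` is rigid among the products of kind `P`: all its formal deformations are trivial. -/
def IsRigid (P : ((ℕ → V) → (ℕ → V) → (ℕ → V)) → Prop) (q : V →ₗ[K] V →ₗ[K] V) : Prop :=
  ∀ c : ℕ → V →ₗ[K] V →ₗ[K] V, IsFormalDeformation P q c → IsTrivialDeformation q c

/-- The coefficients of `q + t c`. -/
def firstOrder (q c : V →ₗ[K] V →ₗ[K] V) : ℕ → V →ₗ[K] V →ₗ[K] V :=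
  fun k => if k = 0 then q else if k = 1 then c else 0

/-- `q + t c` is a true deformation of `q` at order 1, among the products of kind `P`, where `B2`
is the space of 2-coboundaries of the cohomology attached to this kind of products. -/
def IsTrueDeformationOrderOne (P : ((ℕ → V) → (ℕ → V) → (ℕ → V)) → Prop)
    (B2 : Submodule K (V →ₗ[K] V →ₗ[K] V)) (q c : V →ₗ[K] V →ₗ[K] V) : Prop :=
  IsFormalDeformation P q (firstOrder q c) ∧ c ∉ B2

end Deformation

/-! ### Second cohomology groups with adjoint coefficients -/

section Cohomology

variable {K V : Type*} [Field K] [AddCommGroup V] [Module K V]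

/-- The coboundary operator from 1-cochains to 2-cochains, both for the Hochschild complex of an
associative product and for the complex of a left pre-Lie product. -/
def coboundaryOne (q : V →ₗ[K] V →ₗ[K] V) : (V →ₗ[K] V) →ₗ[K] (V →ₗ[K] V →ₗ[K] V) where
  toFun f := LinearMap.mk₂ K (fun x y => q x (f y) - f (q x y) + q (f x) y)
    (fun _ _ _ => by simp; abel) (fun _ _ _ => by simp [smul_sub])
    (fun _ _ _ => by simp; abel) (fun _ _ _ => by simp [smul_sub])
  map_add' _ _ := by ext; simp; abel
  map_smul' _ _ := by ext; simp [smul_sub]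

/-- The Hochschild coboundary operator from 2-cochains to 3-cochains. -/
def hochschildTwo (q : V →ₗ[K] V →ₗ[K] V) :
    (V →ₗ[K] V →ₗ[K] V) →ₗ[K] (V →ₗ[K] V →ₗ[K] V →ₗ[K] V) where
  toFun c :=
    { toFun := fun x => LinearMap.mk₂ K
        (fun y z => q x (c y z) - c (q x y) z + c x (q y z) - q (c x y) z)
        (fun _ _ _ => by simp; abel) (fun _ _ _ => by simp [smul_sub])
        (fun _ _ _ => by simp; abel) (fun _ _ _ => by simp [smul_sub])
      map_add' := fun _ _ => by ext; simp; abel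
      map_smul' := fun _ _ => by ext; simp [smul_sub] }
  map_add' _ _ := by ext; simp; abel
  map_smul' _ _ := by ext; simp [smul_sub]

/-- The pre-Lie coboundary operator from 2-cochains `V ⊗ V → V` to 3-cochains `Λ²V ⊗ V → V`,
where `[x, y] = q(x, y) - q(y, x)`. -/
def preLieTwo (q : V →ₗ[K] V →ₗ[K] V) :
    (V →ₗ[K] V →ₗ[K] V) →ₗ[K] (V →ₗ[K] V →ₗ[K] V →ₗ[K] V) where
  toFun c :=
    { toFun := fun x => LinearMap.mk₂ K
        (fun y z => (q (c y x) z - q (c x y) z) - (c y (q x z) - c x (q y z))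
          - c (q x y - q y x) z + (q x (c y z) - q y (c x z)))
        (fun _ _ _ => by simp; abel) (fun _ _ _ => by simp [smul_sub])
        (fun _ _ _ => by simp; abel) (fun _ _ _ => by simp [smul_sub])
      map_add' := fun _ _ => by ext; simp; abel
      map_smul' := fun _ _ => by ext; simp [smul_sub] }
  map_add' _ _ := by ext; simp; abel
  map_smul' _ _ := by ext; simp [smul_sub]

/-- The Hochschild cohomology group `H²(V, V)` of the associative product `q`. -/
abbrev HochschildH2 (q : V →ₗ[K] V →ₗ[K] V) : Type _ :=
  LinearMap.ker (hochschildTwo q) ⧸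
    (LinearMap.range (coboundaryOne q)).submoduleOf (LinearMap.ker (hochschildTwo q))

/-- The space of 2-cocycles of the left pre-Lie product `q`. -/
def preLieZ2 (q : V →ₗ[K] V →ₗ[K] V) : Submodule K (V →ₗ[K] V →ₗ[K] V) :=
  LinearMap.ker (preLieTwo q)

/-- The space of 2-coboundaries of the left pre-Lie product `q`. -/
def preLieB2 (q : V →ₗ[K] V →ₗ[K] V) : Submodule K (V →ₗ[K] V →ₗ[K] V) :=
  LinearMap.range (coboundaryOne q)

/-- The pre-Lie cohomology group `H²(V, V)` of the left pre-Lie product `q`. -/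
abbrev PreLieH2 (q : V →ₗ[K] V →ₗ[K] V) : Type _ :=
  preLieZ2 q ⧸ (preLieB2 q).submoduleOf (preLieZ2 q)

/-- The Chevalley cohomology group `H²(L, L)` of the Lie algebra `L`. -/
abbrev ChevalleyH2 (K L : Type*) [Field K] [LieRing L] [LieAlgebra K L] : Type _ :=
  LieModule.Cohomology.twoCocycle K L L ⧸
    (LinearMap.range (LieModule.Cohomology.d₁₂ K L L)).submoduleOf
      (LieModule.Cohomology.twoCocycle K L L)

end Cohomology

/-! ### Matrices -/

section Matrices

variable (K : Type*) [Field K] (n : ℕ)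

/-- The matrix product, as a bilinear map. -/
def matMul : Matrix (Fin n) (Fin n) K →ₗ[K] Matrix (Fin n) (Fin n) K →ₗ[K]
    Matrix (Fin n) (Fin n) K :=
  LinearMap.mul K (Matrix (Fin n) (Fin n) K)

/-- The bracket `[x, y] = xy - yx` of `gl_n(K)`, as a bilinear map. -/
def matBracket : Matrix (Fin n) (Fin n) K →ₗ[K] Matrix (Fin n) (Fin n) K →ₗ[K]
    Matrix (Fin n) (Fin n) K :=
  LinearMap.mul K (Matrix (Fin n) (Fin n) K) - (LinearMap.mul K (Matrix (Fin n) (Fin n) K)).flip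

variable {K n}

/-- The bilinear map `c_a(x, y) = (1/n) tr(x) [y, a]`. -/
def traceCochain (a : Matrix (Fin n) (Fin n) K) :
    Matrix (Fin n) (Fin n) K →ₗ[K] Matrix (Fin n) (Fin n) K →ₗ[K] Matrix (Fin n) (Fin n) K :=
  LinearMap.mk₂ K (fun x y => ((1 / (n : K)) * x.trace) • (y * a - a * y))
    (fun _ _ _ => by simp [mul_add, add_smul]) (fun _ _ _ => by simp [smul_smul, mul_left_comm])
    (fun _ _ _ => by rw [← smul_add]; congr 1; simp [add_mul, mul_add]; abel)
    (fun r x y => by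
      rw [smul_comm]; congr 1; simp [smul_sub])

end Matrices

/-! Rigidity in the associative and Lie cases follows from the vanishing of 2-cocycles modulo
coboundaries, by trivializing `q_t` one order at a time. If `φ_t` intertwines `q` and `q_t` below
order N, the defect at order N is a 2-cocycle, by the identity for `q_t` evaluated on `φ_t`-images;
changing the N-th coefficient of `φ_t` adds a coboundary to the defect (`obstruction_update`). The
corrections stabilize coefficientwise, so they have a limit (`isTrivialDeformation_of_obstruction`).

Both vanishing results come from explicit contractions. For `M_n` it is the separability element `∑
e_{i0} ⊗ e_{0i}`. For `gl_n` it is the Casimir element `∑ e_{ij} ⊗ e_{ji}`, which acts on the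
adjoint representation by `x ↦ 2n x - 2 tr(x) 1` (`casimir_adjoint`). This kills scalars, so
`casimir_homotopy` leaves over the scalar cocycle `tr ∘ c`, which `exists_scalar_primitive` shows to
be exact.

In the pre-Lie case `c_a` is a cocycle because `[·, a]` is a derivation and the trace is symmetric,
and `q + t c_a` is pre-Lie exactly because traces of commutators vanish at order 2. Evaluating at `x
= 1` shows that `c_a` is a coboundary only if `a` is central, and the linear term of a trivial
deformation must be a coboundary. -/

/-! ### Calculus of `K[[t]]`-bilinear products on coefficient sequences. -/

section Series

variable {K V W : Type*} [Field K] [AddCommGroup V] [Module K V] [AddCommGroup W]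

/-- Multiplication by `t` on series. -/
def seriesShift (u : ℕ → V) : ℕ → V
  | 0 => 0
  | k + 1 => u k

lemma single_add_seriesShift (u : ℕ → V) :
    (Pi.single 0 (u 0) : ℕ → V) + seriesShift (fun k => u (k + 1)) = u := by
  ext k
  cases k <;> simp [seriesShift]

/-- Additive maps on series that commute with `t` are equal once they agree on constants. -/
lemma series_ext {E F : (ℕ → V) → (ℕ → W)}
    (hE : ∀ u v, E (u + v) = E u + E v) (hF : ∀ u v, F (u + v) = F u + F v)
    (hEs : ∀ u, E (seriesShift u) = seriesShift (E u))
    (hFs : ∀ u, F (seriesShift u) = seriesShift (F u))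
    (h : ∀ x, E (Pi.single 0 x) = F (Pi.single 0 x)) (u : ℕ → V) : E u = F u := by
  ext N
  -- Infinite sums never enter: the coefficient of `t^N` only needs the splitting `u = u₀ + t u'`
  -- repeated N + 1 times.
  induction N generalizing u with
  | zero =>
    rw [← single_add_seriesShift u, hE, hF, hEs, hFs, h]
    simp [seriesShift]
  | succ N ih =>
    rw [← single_add_seriesShift u, hE, hF, hEs, hFs, h]
    simp [seriesShift, ih]

lemma seriesShift_add (u v : ℕ → V) :
    seriesShift (u + v) = seriesShift u + seriesShift v := by
  ext k
  cases k <;> simp [seriesShift]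

lemma seriesShift_sub (u v : ℕ → V) :
    seriesShift (u - v) = seriesShift u - seriesShift v := by
  ext k
  cases k <;> simp [seriesShift]

variable (c : ℕ → V →ₗ[K] V →ₗ[K] V) (b : ℕ → V →ₗ[K] V)

lemma seriesMul_add_left (u u' v : ℕ → V) :
    seriesMul c (u + u') v = seriesMul c u v + seriesMul c u' v := by
  ext N
  simp [seriesMul, Finset.sum_add_distrib]

lemma seriesMul_add_right (u v v' : ℕ → V) :
    seriesMul c u (v + v') = seriesMul c u v + seriesMul c u v' := by
  ext N
  simp [seriesMul, Finset.sum_add_distrib]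

lemma seriesMap_add (u v : ℕ → V) :
    seriesMap b (u + v) = seriesMap b u + seriesMap b v := by
  ext N
  simp [seriesMap, Finset.sum_add_distrib]

lemma seriesMap_shift (u : ℕ → V) :
    seriesMap b (seriesShift u) = seriesShift (seriesMap b u) := by
  ext N
  cases N with
  | zero => simp [seriesMap, seriesShift]
  | succ N => simp [seriesMap, seriesShift, Finset.Nat.sum_antidiagonal_succ']

lemma seriesMul_shift_left (u v : ℕ → V) :
    seriesMul c (seriesShift u) v = seriesShift (seriesMul c u v) := by
  ext N
  cases N with
  | zero => simp [seriesMul, seriesShift]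
  | succ N =>
    simp [seriesMul, seriesShift, Finset.Nat.sum_antidiagonal_succ' (n := N),
      Finset.Nat.sum_antidiagonal_succ]

lemma seriesMul_shift_right (u v : ℕ → V) :
    seriesMul c u (seriesShift v) = seriesShift (seriesMul c u v) := by
  ext N
  cases N with
  | zero => simp [seriesMul, seriesShift]
  | succ N => simp [seriesMul, seriesShift, Finset.Nat.sum_antidiagonal_succ']

lemma seriesMap_single (x : V) : seriesMap b (Pi.single 0 x) = fun k => b k x := by
  ext N
  rw [seriesMap, Finset.sum_eq_single (N, 0)]
  · simp
  · rintro ⟨i, j⟩ hp hne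
    have : j ≠ 0 := by
      rintro rfl
      simp at hp
      simp [hp] at hne
    simp [this]
  · simp

lemma seriesMul_single_single (x y : V) :
    seriesMul c (Pi.single 0 x) (Pi.single 0 y) = fun k => c k x y := by
  ext N
  rw [seriesMul, Finset.sum_eq_single (N, 0)]
  · simp
  · rintro ⟨i, j⟩ hp hne
    have hj : j ≠ 0 := by
      rintro rfl
      simp at hp
      simp [hp] at hne
    refine Finset.sum_eq_zero ?_
    rintro ⟨k, l⟩ hkl
    simp only [Finset.HasAntidiagonal.mem_antidiagonal] at hkl
    by_cases hk : k = 0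
    · have : l ≠ 0 := by omega
      simp [this]
    · simp [hk]
  · simp

variable {c b}

/-- Since `u` is divisible by `t^N`, only its leading coefficient can reach order N, paired with the
constant terms of the product and of `v`. -/
lemma seriesMul_eq_of_left {u v : ℕ → V} {N : ℕ} (h : ∀ k < N, u k = 0) :
    seriesMul c u v N = c 0 (u N) (v 0) := by
  rw [seriesMul, Finset.sum_eq_single (0, N), Finset.sum_eq_single (N, 0)]
  · rintro ⟨k, l⟩ hkl hne
    simp only [Finset.HasAntidiagonal.mem_antidiagonal] at hkl
    have : k < N := by
      rcases Nat.lt_or_ge k N with h | h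
      · exact h
      · exact absurd (Prod.ext (by simp; omega) (by simp; omega)) hne
    simp [h k this]
  · simp
  · rintro ⟨i, j⟩ hp hne
    simp only [Finset.HasAntidiagonal.mem_antidiagonal] at hp
    refine Finset.sum_eq_zero ?_
    rintro ⟨k, l⟩ hkl
    simp only [Finset.HasAntidiagonal.mem_antidiagonal] at hkl
    have : k < N := by
      rcases Nat.lt_or_ge k N with h | h
      · exact h
      · exact absurd (Prod.ext (by simp; omega) (by simp; omega)) hne
    simp [h k this]
  · simp

lemma seriesMul_eq_of_right {u v : ℕ → V} {N : ℕ} (h : ∀ k < N, v k = 0) :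
    seriesMul c u v N = c 0 (u 0) (v N) := by
  rw [seriesMul, Finset.sum_eq_single (0, N), Finset.sum_eq_single (0, N)]
  · rintro ⟨k, l⟩ hkl hne
    simp only [Finset.HasAntidiagonal.mem_antidiagonal] at hkl
    have : l < N := by
      rcases Nat.lt_or_ge l N with h | h
      · exact h
      · exact absurd (Prod.ext (by simp; omega) (by simp; omega)) hne
    simp [h l this]
  · simp
  · rintro ⟨i, j⟩ hp hne
    simp only [Finset.HasAntidiagonal.mem_antidiagonal] at hp
    refine Finset.sum_eq_zero ?_
    rintro ⟨k, l⟩ hkl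
    simp only [Finset.HasAntidiagonal.mem_antidiagonal] at hkl
    have : l < N := by
      rcases Nat.lt_or_ge l N with h | h
      · exact h
      · exact absurd (Prod.ext (by simp; omega) (by simp; omega)) hne
    simp [h l this]
  · simp

/-- First order variation of `q_t` in the left argument. -/
lemma seriesMul_congr_left {u u' v : ℕ → V} {N : ℕ} {r : V} (h : ∀ k < N, u k = u' k)
    (hN : u N = u' N + r) :
    seriesMul c u v N = seriesMul c u' v N + c 0 r (v 0) := by
  have hu : u = u' + (u - u') := by abel
  rw [hu, seriesMul_add_left, Pi.add_apply,
    seriesMul_eq_of_left (u := u - u') (fun k hk => by simp [h k hk])]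
  simp [hN]

/-- First order variation of `q_t` in the right argument. -/
lemma seriesMul_congr_right {u v v' : ℕ → V} {N : ℕ} {r : V} (h : ∀ k < N, v k = v' k)
    (hN : v N = v' N + r) :
    seriesMul c u v N = seriesMul c u v' N + c 0 (u 0) r := by
  have hv : v = v' + (v - v') := by abel
  rw [hv, seriesMul_add_right, Pi.add_apply,
    seriesMul_eq_of_right (v := v - v') (fun k hk => by simp [h k hk])]
  simp [hN]

/-! ### Obstructions to trivializing a deformation. -/

variable (c b) in
/-- The coefficient of `t^N` in `q_t (φ_t x, φ_t y) - φ_t (q (x, y))`. -/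
def obstruction (N : ℕ) : V →ₗ[K] V →ₗ[K] V :=
  ∑ p ∈ Finset.HasAntidiagonal.antidiagonal N,
    ∑ r ∈ Finset.HasAntidiagonal.antidiagonal p.2, (c p.1).compl₁₂ (b r.1) (b r.2)
  - (c 0).compr₂ (b N)

lemma obstruction_apply (N : ℕ) (x y : V) :
    obstruction c b N x y =
      seriesMul c (fun k => b k x) (fun k => b k y) N - b N (c 0 x y) := by
  simp [obstruction, seriesMul, LinearMap.sum_apply]

lemma seriesMul_eq_add_obstruction (N : ℕ) (x y : V) :
    seriesMul c (fun k => b k x) (fun k => b k y) N = b N (c 0 x y) + obstruction c b N x y := by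
  rw [obstruction_apply]; abel

/-- `q_t (φ_t x, φ_t y)` and `φ_t (q (x, y))` differ by the obstruction at the first order where
they may be different. -/
lemma seriesMul_seriesMul_left {N : ℕ} (hb : b 0 = LinearMap.id)
    (h : ∀ k < N, obstruction c b k = 0) (x y z : V) :
    seriesMul c (seriesMul c (fun k => b k x) (fun k => b k y)) (fun k => b k z) N =
      b N (c 0 (c 0 x y) z) + obstruction c b N (c 0 x y) z
        + c 0 (obstruction c b N x y) z := by
  rw [seriesMul_congr_left (u' := fun k => b k (c 0 x y)) (r := obstruction c b N x y),
    seriesMul_eq_add_obstruction]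
  · simp [hb]
  · intro k hk
    simp [seriesMul_eq_add_obstruction, h k hk]
  · rw [seriesMul_eq_add_obstruction]

lemma seriesMul_seriesMul_right {N : ℕ} (hb : b 0 = LinearMap.id)
    (h : ∀ k < N, obstruction c b k = 0) (x y z : V) :
    seriesMul c (fun k => b k x) (seriesMul c (fun k => b k y) (fun k => b k z)) N =
      b N (c 0 x (c 0 y z)) + obstruction c b N x (c 0 y z)
        + c 0 x (obstruction c b N y z) := by
  rw [seriesMul_congr_right (v' := fun k => b k (c 0 y z)) (r := obstruction c b N y z),
    seriesMul_eq_add_obstruction]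
  · simp [hb]
  · intro k hk
    simp [seriesMul_eq_add_obstruction, h k hk]
  · rw [seriesMul_eq_add_obstruction]

lemma obstruction_congr {b' : ℕ → V →ₗ[K] V} {N : ℕ} (h : ∀ k ≤ N, b k = b' k) :
    obstruction c b N = obstruction c b' N := by
  unfold obstruction
  rw [h N le_rfl]
  congr 1
  refine Finset.sum_congr rfl fun p hp => Finset.sum_congr rfl fun r hr => ?_
  simp only [Finset.HasAntidiagonal.mem_antidiagonal] at hp hr
  rw [h r.1 (by omega), h r.2 (by omega)]

lemma obstruction_zero (hb : b 0 = LinearMap.id) : obstruction c b 0 = 0 := by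
  ext x y
  simp [obstruction, hb]

/-- At order N the new term `f` meets only constant terms, which are `q` and the identity; this
makes the obstruction well defined modulo coboundaries. -/
lemma obstruction_update {N : ℕ} (hN : N ≠ 0) (hb : b 0 = LinearMap.id) (f : V →ₗ[K] V) :
    obstruction c (Function.update b N (b N + f)) N =
      obstruction c b N + coboundaryOne (c 0) f := by
  ext x y
  have hlt : ∀ z, ∀ k < N, Function.update b N (b N + f) k z = b k z := fun z k hk => by
    rw [Function.update_of_ne hk.ne]
  have hNN : ∀ z, Function.update b N (b N + f) N z = b N z + f z := by simp
  have h0 : ∀ z, Function.update b N (b N + f) 0 z = z := fun z => by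
    rw [Function.update_of_ne hN.symm, hb]; rfl
  rw [obstruction_apply, seriesMul_congr_left (hlt x) (hNN x),
    seriesMul_congr_right (hlt y) (hNN y), seriesMul_eq_add_obstruction, h0, hNN, hb]
  simp [coboundaryOne]
  abel

/-- A deformation is trivial if all the obstructions to trivializing it are coboundaries. -/
theorem isTrivialDeformation_of_obstruction
    (H : ∀ (N : ℕ) (b : ℕ → V →ₗ[K] V), b 0 = LinearMap.id →
      (∀ k < N, obstruction c b k = 0) → ∃ f, obstruction c b N = coboundaryOne (c 0) f) :
    IsTrivialDeformation (c 0) c := by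
  let S (N : ℕ) := {b : ℕ → V →ₗ[K] V // b 0 = LinearMap.id ∧ ∀ k ≤ N, obstruction c b k = 0}
  have step : ∀ (N : ℕ) (b : S N), ∃ b' : S (N + 1), ∀ k ≤ N, b'.1 k = b.1 k := by
    rintro N ⟨b, hb, h⟩
    obtain ⟨f, hf⟩ := H (N + 1) b hb (fun k hk => h k (by omega))
    have hlt : ∀ k ≤ N, Function.update b (N + 1) (b (N + 1) + -f) k = b k := fun k hk => by
      rw [Function.update_of_ne (by omega)]
    refine ⟨⟨Function.update b (N + 1) (b (N + 1) + -f), ?_, ?_⟩, hlt⟩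
    · rw [hlt 0 (by omega), hb]
    · intro k hk
      rcases Nat.lt_or_ge N k with h' | h'
      · obtain rfl : k = N + 1 := by omega
        rw [obstruction_update (by omega) hb, hf, map_neg, add_neg_cancel]
      · rw [obstruction_congr (fun j hj => hlt j (hj.trans h')), h k h']
  choose next hnext using step
  -- Stage N + 1 leaves the coefficients up to N unchanged, so the diagonal `k ↦ (B k).1 k` agrees
  -- with stage N up to order N and has no obstruction at any order.
  let B : ∀ N, S N := fun N => Nat.rec
    ⟨fun k => if k = 0 then LinearMap.id else 0, by simp, fun k hk => by
      obtain rfl : k = 0 := Nat.le_zero.mp hk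
      exact obstruction_zero (by simp)⟩ (fun N b => next N b) N
  have hB : ∀ N k, k ≤ N → (B N).1 k = (B k).1 k := by
    intro N k hk
    induction N, hk using Nat.le_induction with
    | base => rfl
    | succ N hk ih => exact (hnext N (B N) k hk).trans ih
  refine ⟨fun k => (B k).1 k, (B 0).2.1, ?_⟩
  have hobs : ∀ N, obstruction c (fun k => (B k).1 k) N = 0 := fun N => by
    rw [obstruction_congr (b' := (B N).1) fun k hk => (hB N k hk).symm, (B N).2.2 N le_rfl]
  generalize (fun k => (B k).1 k) = b at hobs
  intro u v
  refine series_ext (E := fun u => seriesMul c (seriesMap b u) (seriesMap b v))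
    (F := fun u => seriesMap b (seriesMul (fun k => if k = 0 then c 0 else 0) u v))
    (by simp [seriesMap_add, seriesMul_add_left]) (by simp [seriesMap_add, seriesMul_add_left])
    (by simp [seriesMap_shift, seriesMul_shift_left])
    (by simp [seriesMap_shift, seriesMul_shift_left]) (fun x => ?_) u
  refine series_ext (E := fun v => seriesMul c (seriesMap b (Pi.single 0 x)) (seriesMap b v))
    (F := fun v => seriesMap b (seriesMul (fun k => if k = 0 then c 0 else 0) (Pi.single 0 x) v))
    (by simp [seriesMap_add, seriesMul_add_right]) (by simp [seriesMap_add, seriesMul_add_right])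
    (by simp [seriesMap_shift, seriesMul_shift_right])
    (by simp [seriesMap_shift, seriesMul_shift_right]) (fun y => ?_) v
  have hs : (fun k => (if k = 0 then c 0 else 0 : V →ₗ[K] V →ₗ[K] V) x y) =
      Pi.single 0 (c 0 x y) := by
    ext k
    by_cases hk : k = 0
    · subst hk; simp
    · simp [hk]
  rw [seriesMul_single_single, hs]
  simp only [seriesMap_single]
  ext N
  rw [seriesMul_eq_add_obstruction, hobs]
  simp

/-- An associative product is rigid if its Hochschild 2-cocycles are coboundaries. -/
theorem isRigid_isAssocProduct {q : V →ₗ[K] V →ₗ[K] V}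
    (H : ∀ d, hochschildTwo q d = 0 → ∃ f, d = coboundaryOne q f) :
    IsRigid IsAssocProduct q := by
  rintro c ⟨rfl, hc⟩
  refine isTrivialDeformation_of_obstruction fun N b hb h => H _ ?_
  have hq : ∀ x y z, c 0 (c 0 x y) z = c 0 x (c 0 y z) := fun x y z => by
    have := congrFun (hc (Pi.single 0 x) (Pi.single 0 y) (Pi.single 0 z)) 0
    simpa [seriesMul] using this
  ext x y z
  -- Associativity on the images `φ_t x, φ_t y, φ_t z`: the `b N` terms cancel by associativity of
  -- `q`, and what remains is the cocycle identity for the obstruction.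
  have := congrFun (hc (fun k => b k x) (fun k => b k y) (fun k => b k z)) N
  rw [seriesMul_seriesMul_left hb h, seriesMul_seriesMul_right hb h, hq, add_assoc, add_assoc,
    add_right_inj] at this
  simp only [hochschildTwo, LinearMap.coe_mk, AddHom.coe_mk, LinearMap.mk₂_apply,
    LinearMap.zero_apply]
  rw [← sub_eq_zero] at this
  rw [← neg_eq_zero, ← this]
  abel

/-- A Lie bracket is rigid if its alternating 2-cocycles are coboundaries. -/
theorem isRigid_isLieBracket {q : V →ₗ[K] V →ₗ[K] V}
    (H : ∀ d : V →ₗ[K] V →ₗ[K] V, (∀ x, d x x = 0) →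
      (∀ x y z, d x (q y z) + q x (d y z) + (d y (q z x) + q y (d z x))
        + (d z (q x y) + q z (d x y)) = 0) → ∃ f, d = coboundaryOne q f) :
    IsRigid IsLieBracket q := by
  rintro c ⟨rfl, hc, hc'⟩
  refine isTrivialDeformation_of_obstruction fun N b hb h => H _ (fun x => ?_) (fun x y z => ?_)
  · have h1 := congrFun (hc (Pi.single 0 x)) 0
    have h2 := congrFun (hc (fun k => b k x)) N
    rw [seriesMul_single_single] at h1
    rw [obstruction_apply, h2]
    simp_all
  · have h1 := congrFun (hc' (Pi.single 0 x) (Pi.single 0 y) (Pi.single 0 z)) 0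
    have h1 : c 0 x (c 0 y z) + c 0 y (c 0 z x) + c 0 z (c 0 x y) = 0 := by
      simpa [seriesMul] using h1
    have h2 := congrFun (hc' (fun k => b k x) (fun k => b k y) (fun k => b k z)) N
    simp only [Pi.add_apply, seriesMul_seriesMul_right hb h, Pi.zero_apply] at h2
    have h3 := congrArg (b N) h1
    simp only [map_add, map_zero] at h3
    rw [← h2, ← sub_eq_zero, ← neg_eq_zero, ← h3]
    abel

end Series

/-! ### Vanishing of the second Hochschild and Chevalley cohomology of matrices. -/

section MatrixCohomology

variable {K W : Type*} [Field K] [AddCommGroup W] [Module K W] {n : ℕ}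

/-- The Hochschild 2-cocycles of the matrix algebra are coboundaries. -/
theorem exists_eq_coboundaryOne_of_hochschildTwo_eq_zero
    (c : Matrix (Fin n) (Fin n) K →ₗ[K] Matrix (Fin n) (Fin n) K →ₗ[K] Matrix (Fin n) (Fin n) K)
    (hc : hochschildTwo (matMul K n) c = 0) : ∃ f, c = coboundaryOne (matMul K n) f := by
  obtain _ | n := n
  · exact ⟨0, LinearMap.ext fun x => LinearMap.ext fun y => Subsingleton.elim _ _⟩
  let e (i : Fin (n + 1)) : Matrix (Fin (n + 1)) (Fin (n + 1)) K := Matrix.single i 0 1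
  let e' (i : Fin (n + 1)) : Matrix (Fin (n + 1)) (Fin (n + 1)) K := Matrix.single 0 i 1
  have hone : ∑ i, e i * e' i = 1 := by simp [e, e', Matrix.sum_single_one]
  have hleft : ∀ y i, e' i * y = ∑ j, y i j • e' j := by
    intro y i
    ext k l
    simp only [e', Matrix.sum_apply, Matrix.smul_apply, Matrix.single_apply, smul_eq_mul]
    by_cases hk : 0 = k
    · subst hk
      simp
    · rw [Matrix.single_mul_apply_of_ne _ _ _ _ _ (Ne.symm hk)]
      simp [hk]
  have hright : ∀ y j, y * e j = ∑ i, y i j • e i := by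
    intro y j
    ext k l
    simp only [e, Matrix.sum_apply, Matrix.smul_apply, Matrix.single_apply, smul_eq_mul]
    by_cases hl : 0 = l
    · subst hl
      simp
    · rw [Matrix.mul_single_apply_of_ne _ _ _ _ _ (Ne.symm hl)]
      simp [hl]
  -- The primitive is `f(z) = ∑ e_{i0} c(e_{0i}, z)`: multiply the cocycle identity at `(e_{0i}, y,
  -- z)` by `e_{i0}` and sum, using `∑ e_{i0} e_{0i} = 1`.
  refine ⟨∑ i, (matMul K (n + 1) (e i)) ∘ₗ c (e' i), ?_⟩
  ext1 y
  ext1 z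
  have key : ∀ i, e i * (e' i * c y z - c (e' i * y) z + c (e' i) (y * z) - c (e' i) y * z) = 0 :=
    fun i => by
      have := congrArg (fun d => e i * d (e' i) y z) hc
      simpa [hochschildTwo, matMul] using this
  -- This is `∑ e_{i0} ⊗ e_{0i} y = ∑ y e_{i0} ⊗ e_{0i}`.
  have hswap : ∑ i, e i * c (e' i * y) z = y * ∑ i, e i * c (e' i) z := by
    simp only [hleft, map_sum, map_smul, LinearMap.sum_apply, LinearMap.smul_apply,
      Finset.mul_sum, ← mul_assoc, hright, Finset.sum_mul, Matrix.mul_smul, Matrix.smul_mul]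
    exact Finset.sum_comm
  have hsum := Finset.sum_eq_zero (s := Finset.univ) fun i _ => key i
  simp only [mul_sub, mul_add, Finset.sum_sub_distrib, Finset.sum_add_distrib, hswap,
    ← mul_assoc] at hsum
  rw [← Finset.sum_mul, ← Finset.sum_mul, hone, one_mul] at hsum
  simp only [coboundaryOne, matMul, LinearMap.coe_mk, AddHom.coe_mk, LinearMap.mk₂_apply,
    LinearMap.sum_apply, LinearMap.comp_apply, LinearMap.mul_apply']
  rw [← sub_eq_zero, ← hsum]
  abel

/-! ### The Casimir element `∑ e_{ij} ⊗ e_{ji}` -/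

variable (K) in
/-- The elementary matrix `e_{ij}`, indexed by pairs. -/
def elemMat (p : Fin n × Fin n) : Matrix (Fin n) (Fin n) K := Matrix.single p.1 p.2 1

lemma sum_swap (F : Fin n × Fin n → W) : ∑ p : Fin n × Fin n, F p.swap = ∑ p, F p :=
  Fintype.sum_equiv (Equiv.prodComm _ _) _ _ fun _ => rfl

lemma mul_elemMat (x : Matrix (Fin n) (Fin n) K) (p : Fin n × Fin n) :
    x * elemMat K p = ∑ k, x k p.1 • elemMat K (k, p.2) := by
  ext k l
  simp only [elemMat, Matrix.sum_apply, Matrix.smul_apply, Matrix.single_apply, smul_eq_mul]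
  by_cases hl : p.2 = l
  · subst hl
    simp
  · rw [Matrix.mul_single_apply_of_ne _ _ _ _ _ (Ne.symm hl)]
    simp [hl]

lemma elemMat_mul (x : Matrix (Fin n) (Fin n) K) (p : Fin n × Fin n) :
    elemMat K p * x = ∑ k, x p.2 k • elemMat K (p.1, k) := by
  ext k l
  simp only [elemMat, Matrix.sum_apply, Matrix.smul_apply, Matrix.single_apply, smul_eq_mul]
  by_cases hk : p.1 = k
  · subst hk
    simp
  · rw [Matrix.single_mul_apply_of_ne _ _ _ _ _ (Ne.symm hk)]
    simp [hk]

/-- Expanding `x e_{ij}` and `e_{ji} x` in elementary matrices gives the same triple sum up to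
renaming indices. -/
lemma casimir_mul_left
    (B : Matrix (Fin n) (Fin n) K →ₗ[K] Matrix (Fin n) (Fin n) K →ₗ[K] W)
    (x : Matrix (Fin n) (Fin n) K) :
    ∑ p, B (x * elemMat K p) (elemMat K p.swap) = ∑ p, B (elemMat K p) (elemMat K p.swap * x) := by
  simp only [mul_elemMat, elemMat_mul, map_sum, map_smul, LinearMap.sum_apply,
    LinearMap.smul_apply, Fintype.sum_prod_type, Prod.fst_swap, Prod.snd_swap, Prod.swap_prod_mk]
  calc _ = ∑ i, ∑ k, ∑ j, x k i • B (elemMat K (k, j)) (elemMat K (j, i)) :=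
        Finset.sum_congr rfl fun _ _ => Finset.sum_comm
    _ = ∑ k, ∑ i, ∑ j, x k i • B (elemMat K (k, j)) (elemMat K (j, i)) := Finset.sum_comm
    _ = _ := Finset.sum_congr rfl fun _ _ => Finset.sum_comm

lemma casimir_mul_right
    (B : Matrix (Fin n) (Fin n) K →ₗ[K] Matrix (Fin n) (Fin n) K →ₗ[K] W)
    (x : Matrix (Fin n) (Fin n) K) :
    ∑ p, B (elemMat K p * x) (elemMat K p.swap) = ∑ p, B (elemMat K p) (x * elemMat K p.swap) := by
  have := casimir_mul_left B.flip x
  simp only [LinearMap.flip_apply] at this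
  rw [← sum_swap, ← sum_swap (fun p => B (elemMat K p) (x * elemMat K p.swap))]
  simpa using this.symm

/-- Invariance of the Casimir element. -/
lemma casimir_invariant
    (B : Matrix (Fin n) (Fin n) K →ₗ[K] Matrix (Fin n) (Fin n) K →ₗ[K] W)
    (x : Matrix (Fin n) (Fin n) K) :
    ∑ p, B (elemMat K p) (x * elemMat K p.swap - elemMat K p.swap * x) =
      -∑ p, B (x * elemMat K p - elemMat K p * x) (elemMat K p.swap) := by
  simp only [map_sub, LinearMap.sub_apply, Finset.sum_sub_distrib, casimir_mul_left,
    casimir_mul_right]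
  abel

/-- Each term is `e_{ij} x e_{ji} = x_{jj} e_{ii}`. -/
lemma sum_elemMat_mul_mul (x : Matrix (Fin n) (Fin n) K) :
    ∑ p, elemMat K p * x * elemMat K p.swap = x.trace • 1 := by
  simp only [elemMat, Matrix.single_mul_mul_single, Fintype.sum_prod_type, Prod.fst_swap,
    Prod.snd_swap, one_mul, mul_one]
  rw [Finset.sum_comm, Matrix.trace, Finset.sum_smul]
  refine Finset.sum_congr rfl fun j _ => ?_
  rw [Matrix.sum_single_eq_diagonal, Matrix.smul_one_eq_diagonal]
  rfl

lemma sum_elemMat_mul_elemMat :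
    ∑ p : Fin n × Fin n, elemMat K p * elemMat K p.swap = (n : K) • 1 := by
  simpa using sum_elemMat_mul_mul (1 : Matrix (Fin n) (Fin n) K)

lemma sum_elemMat_swap_mul_mul (x : Matrix (Fin n) (Fin n) K) :
    ∑ p, elemMat K p.swap * x * elemMat K p = x.trace • 1 := by
  rw [← sum_elemMat_mul_mul, ← sum_swap]
  simp

lemma sum_elemMat_swap_mul_elemMat :
    ∑ p : Fin n × Fin n, elemMat K p.swap * elemMat K p = (n : K) • 1 := by
  simpa using sum_elemMat_swap_mul_mul (1 : Matrix (Fin n) (Fin n) K)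

/-- The action of the Casimir element on the adjoint representation. -/
lemma casimir_adjoint (x : Matrix (Fin n) (Fin n) K) :
    ∑ p, (elemMat K p * (elemMat K p.swap * x - x * elemMat K p.swap)
      - (elemMat K p.swap * x - x * elemMat K p.swap) * elemMat K p) =
      (2 * n : K) • x - (2 * x.trace) • 1 := by
  have : ∀ p : Fin n × Fin n, elemMat K p * (elemMat K p.swap * x - x * elemMat K p.swap)
      - (elemMat K p.swap * x - x * elemMat K p.swap) * elemMat K p =
      elemMat K p * elemMat K p.swap * x - elemMat K p * x * elemMat K p.swap
        - elemMat K p.swap * x * elemMat K p + x * (elemMat K p.swap * elemMat K p) :=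
    fun p => by noncomm_ring
  simp only [this, Finset.sum_add_distrib, Finset.sum_sub_distrib, ← Finset.sum_mul,
    ← Finset.mul_sum, sum_elemMat_mul_mul, sum_elemMat_mul_elemMat, sum_elemMat_swap_mul_mul,
    sum_elemMat_swap_mul_elemMat, Matrix.smul_mul, Matrix.mul_smul, one_mul, mul_one]
  module

/-! ### Contracting Chevalley 2-cocycles of `gl_n`. -/

lemma matBracket_apply (x y : Matrix (Fin n) (Fin n) K) :
    matBracket K n x y = x * y - y * x := rfl

/-- The Casimir homotopy on 2-cocycles of `gl_n` with adjoint coefficients. -/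
lemma casimir_homotopy
    (c : Matrix (Fin n) (Fin n) K →ₗ[K] Matrix (Fin n) (Fin n) K →ₗ[K] Matrix (Fin n) (Fin n) K)
    (halt : ∀ x, c x x = 0)
    (hc : ∀ x y z, c x (matBracket K n y z) + matBracket K n x (c y z)
      + (c y (matBracket K n z x) + matBracket K n y (c z x))
      + (c z (matBracket K n x y) + matBracket K n z (c x y)) = 0)
    (y z : Matrix (Fin n) (Fin n) K) :
    coboundaryOne (matBracket K n)
      (∑ p, (matBracket K n (elemMat K p)) ∘ₗ c (elemMat K p.swap)) y z =
      (2 * n : K) • c y z - (2 * (c y z).trace) • 1 := by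
  have hskew : ∀ x y, c x y = -c y x := fun x y => by
    have := halt (x + y)
    simp only [map_add, LinearMap.add_apply, halt, zero_add, add_zero] at this
    exact eq_neg_of_add_eq_zero_right this
  have inv : ∀ y z, ∑ p, matBracket K n (elemMat K p) (c (matBracket K n y (elemMat K p.swap)) z)
      = -∑ p, matBracket K n (matBracket K n y (elemMat K p)) (c (elemMat K p.swap) z) :=
    fun y z => by
      simpa [matBracket_apply] using
        casimir_invariant ((matBracket K n).compl₂ (c.flip z)) y
  have h1 := inv y z
  have h2 := inv z y
  -- The cocycle identity at `(e_p*, y, z)`, with `e_p* = elemMat K p.swap`, bracketed with `e_p`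
  -- and rearranged by Jacobi. After summing over `p`, the last four terms cancel in pairs by `inv`,
  -- leaving the Casimir action on `c y z`.
  have key : ∀ p : Fin n × Fin n,
      matBracket K n y (matBracket K n (elemMat K p) (c (elemMat K p.swap) z))
        - matBracket K n (elemMat K p) (c (elemMat K p.swap) (matBracket K n y z))
        + matBracket K n (matBracket K n (elemMat K p) (c (elemMat K p.swap) y)) z
      = matBracket K n (elemMat K p) (matBracket K n (elemMat K p.swap) (c y z))
        + matBracket K n (elemMat K p) (c (matBracket K n y (elemMat K p.swap)) z)
        + matBracket K n (matBracket K n y (elemMat K p)) (c (elemMat K p.swap) z)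
        - matBracket K n (elemMat K p) (c (matBracket K n z (elemMat K p.swap)) y)
        - matBracket K n (matBracket K n z (elemMat K p)) (c (elemMat K p.swap) y) := fun p => by
    have h := hc (elemMat K p.swap) y z
    have e1 : c y (matBracket K n z (elemMat K p.swap)) =
      -c (matBracket K n z (elemMat K p.swap)) y := hskew _ _
    have e2 : c z (matBracket K n (elemMat K p.swap) y) =
        c (matBracket K n y (elemMat K p.swap)) z := by
      rw [hskew, ← LinearMap.neg_apply, ← map_neg]
      simp [matBracket_apply]
    rw [e1, e2, hskew z] at h
    have h := congrArg (matBracket K n (elemMat K p)) h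
    generalize c (elemMat K p.swap) (matBracket K n y z) = c1 at *
    generalize c (matBracket K n z (elemMat K p.swap)) y = c2 at *
    generalize c (matBracket K n y (elemMat K p.swap)) z = c3 at *
    generalize c (elemMat K p.swap) z = c4 at *
    generalize c (elemMat K p.swap) y = c5 at *
    generalize c y z = c6 at *
    simp only [matBracket_apply] at h ⊢
    rw [← sub_eq_zero, ← neg_eq_zero]
    refine Eq.trans ?_ (h.trans (by simp))
    noncomm_ring
  have hsum := Finset.sum_congr (rfl : (Finset.univ : Finset (Fin n × Fin n)) = _)
    fun p _ => key p
  simp only [Finset.sum_add_distrib, Finset.sum_sub_distrib, h1, h2] at hsum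
  have hcas := casimir_adjoint (c y z)
  simp only [coboundaryOne, LinearMap.coe_mk, AddHom.coe_mk, LinearMap.mk₂_apply,
    LinearMap.sum_apply, LinearMap.comp_apply, map_sum, Finset.sum_add_distrib,
    Finset.sum_sub_distrib]
  rw [hsum, ← hcas]
  simp only [matBracket_apply]
  abel

/-- The Casimir homotopy on 2-cocycles of `gl_n` with trivial coefficients. -/
lemma exists_scalar_primitive [CharZero K]
    (w : Matrix (Fin n) (Fin n) K →ₗ[K] Matrix (Fin n) (Fin n) K →ₗ[K] K)
    (halt : ∀ x, w x x = 0)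
    (hw : ∀ x y z, w x (matBracket K n y z) + w y (matBracket K n z x)
      + w z (matBracket K n x y) = 0) :
    ∃ g : Matrix (Fin n) (Fin n) K →ₗ[K] K,
      ∀ y z, g (matBracket K n y z) = 2 * n * w y z := by
  have hskew : ∀ x y, w x y = -w y x := fun x y => by
    have := halt (x + y)
    simp only [map_add, LinearMap.add_apply, halt, zero_add, add_zero] at this
    exact eq_neg_of_add_eq_zero_right this
  have hbskew : ∀ x y, matBracket K n x y = -matBracket K n y x := fun x y => by
    simp [matBracket_apply]
  have hder : ∀ x y z, w x (matBracket K n y z) =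
      w (matBracket K n x y) z + w y (matBracket K n x z) := fun x y z => by
    have := hw x y z
    rw [hbskew z x, map_neg, hskew z] at this
    linear_combination this
  -- Centrality of 1 makes `w 1` vanish on commutators. Summing `[e_p, e_p* y]` gives `n y - tr(y)
  -- 1`, and `w 1 1 = 0`. This disposes of the scalar part of the Casimir action in `hcas`.
  have hunit : ∀ y, w 1 y = 0 := fun y => by
    rcases Nat.eq_zero_or_pos n with rfl | hn
    · rw [Subsingleton.elim y 0, map_zero]
    have hbr : ∀ a b, w 1 (a * b - b * a) = 0 := fun a b => by
      have := hw 1 a b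
      simpa [matBracket_apply] using this
    have hs := Finset.sum_eq_zero (s := Finset.univ)
      fun p _ => hbr (elemMat K p) (elemMat K p.swap * y)
    rw [← map_sum] at hs
    simp only [← mul_assoc, Finset.sum_sub_distrib, ← Finset.sum_mul, sum_elemMat_mul_elemMat,
      sum_elemMat_swap_mul_mul] at hs
    simp only [Matrix.smul_mul, one_mul, map_sub, map_smul, halt, smul_eq_mul, mul_zero, sub_zero,
      mul_eq_zero, Nat.cast_eq_zero] at hs
    exact hs.resolve_left hn.ne'
  refine ⟨∑ p, w (elemMat K p) ∘ₗ matBracket K n (elemMat K p.swap), fun y z => ?_⟩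
  have hcas : ∀ y z, ∑ p, w y (matBracket K n (elemMat K p)
      (matBracket K n (elemMat K p.swap) z)) = 2 * n * w y z := fun y z => by
    have := congrArg (w y) (casimir_adjoint z)
    rw [map_sum, map_sub, map_smul, map_smul, hskew y 1, hunit] at this
    simpa [matBracket_apply] using this
  have hA' : ∑ p, w (matBracket K n (elemMat K p) z) (matBracket K n (elemMat K p.swap) y) =
      -∑ p, w (matBracket K n (elemMat K p) y) (matBracket K n (elemMat K p.swap) z) := by
    rw [← sum_swap, ← Finset.sum_neg_distrib]
    refine Finset.sum_congr rfl fun p _ => ?_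
    rw [hskew, Prod.swap_swap]
  have hA : ∑ p, w (matBracket K n (elemMat K p) y) (matBracket K n (elemMat K p.swap) z) =
      ∑ p, w (elemMat K p) (matBracket K n z (matBracket K n (elemMat K p.swap) y)) := by
    have := casimir_invariant (w.compl₂ ((matBracket K n).flip z)) y
    simp only [LinearMap.compl₂_apply, LinearMap.flip_apply, ← matBracket_apply] at this
    calc _ = -∑ p, w (matBracket K n y (elemMat K p)) (matBracket K n (elemMat K p.swap) z) := by
          rw [← Finset.sum_neg_distrib]
          refine Finset.sum_congr rfl fun p _ => ?_
          rw [hbskew _ y, map_neg, LinearMap.neg_apply]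
      _ = _ := by
          rw [← this]
          refine Finset.sum_congr rfl fun p _ => ?_
          rw [hbskew z, hbskew y, map_neg, LinearMap.neg_apply]
  have hA2 := hA
  simp only [hder _ z, Finset.sum_add_distrib, hA', hcas] at hA2
  have hjac : ∀ p : Fin n × Fin n, matBracket K n (elemMat K p.swap) (matBracket K n y z) =
      matBracket K n y (matBracket K n (elemMat K p.swap) z)
        - matBracket K n z (matBracket K n (elemMat K p.swap) y) := fun p => by
    simp only [matBracket_apply]
    noncomm_ring
  simp only [LinearMap.sum_apply, LinearMap.comp_apply, hjac, map_sub, Finset.sum_sub_distrib]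
  rw [← hA]
  simp only [hder _ y, Finset.sum_add_distrib, hcas]
  ring

/-- The alternating Chevalley 2-cocycles of `gl_n` with adjoint coefficients are coboundaries. -/
theorem exists_eq_coboundaryOne_matBracket [CharZero K]
    (c : Matrix (Fin n) (Fin n) K →ₗ[K] Matrix (Fin n) (Fin n) K →ₗ[K] Matrix (Fin n) (Fin n) K)
    (halt : ∀ x, c x x = 0)
    (hc : ∀ x y z, c x (matBracket K n y z) + matBracket K n x (c y z)
      + (c y (matBracket K n z x) + matBracket K n y (c z x))
      + (c z (matBracket K n x y) + matBracket K n z (c x y)) = 0) :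
    ∃ f, c = coboundaryOne (matBracket K n) f := by
  rcases Nat.eq_zero_or_pos n with rfl | hn
  · exact ⟨0, LinearMap.ext fun x => LinearMap.ext fun y => Subsingleton.elim _ _⟩
  have hn : (n : K) ≠ 0 := Nat.cast_ne_zero.mpr hn.ne'
  have htr : ∀ x y, (matBracket K n x y).trace = 0 := fun x y => by
    rw [matBracket_apply, Matrix.trace_sub, Matrix.trace_mul_comm, sub_self]
  obtain ⟨g, hg⟩ := exists_scalar_primitive (c.compr₂ (Matrix.traceLinearMap (Fin n) K K))
    (fun x => by simp [halt]) fun x y z => by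
      have := congrArg Matrix.trace (hc x y z)
      simpa [htr] using this
  -- The coboundary of the Casimir sum is `2n c - 2 tr(c) 1`. As 1 is central, that of `g · 1` is
  -- `-g([y, z]) 1 = -2n tr(c) 1`, so the factor `n⁻¹` restores the missing trace part.
  refine ⟨(2 * n : K)⁻¹ • (∑ p, (matBracket K n (elemMat K p)) ∘ₗ c (elemMat K p.swap)
    - (n : K)⁻¹ • g.smulRight 1), ?_⟩
  ext1 y
  ext1 z
  rw [map_smul, map_sub, map_smul]
  simp only [LinearMap.smul_apply, LinearMap.sub_apply, casimir_homotopy c halt hc]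
  have : coboundaryOne (matBracket K n) (g.smulRight 1) y z = -(2 * n * (c y z).trace) • 1 := by
    have h := hg y z
    simp only [LinearMap.compr₂_apply, Matrix.traceLinearMap_apply] at h
    simp [coboundaryOne, h, matBracket_apply y 1, matBracket_apply 1 z]
  rw [this, eq_inv_smul_iff₀ (by simpa using hn)]
  match_scalars
  · field_simp
  · field_simp
    ring

end MatrixCohomology

/-! ### Deformations of the form `q + t c`. -/

section FirstOrder

variable {K V : Type*} [Field K] [AddCommGroup V] [Module K V] {q c : V →ₗ[K] V →ₗ[K] V}

lemma seriesMul_firstOrder_single (x y : V) :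
    seriesMul (firstOrder q c) (Pi.single 0 x) (Pi.single 0 y) =
      Pi.single 0 (q x y) + seriesShift (Pi.single 0 (c x y)) := by
  rw [seriesMul_single_single]
  ext k
  rcases k with _ | _ | k <;> simp [firstOrder, seriesShift]

/-- `q + t c` is left pre-Lie if the coefficients of `1`, `t` and `t²` in the pre-Lie identity
vanish. -/
theorem isLeftPreLie_seriesMul_firstOrder
    (h0 : ∀ x y z, q x (q y z) - q (q x y) z = q y (q x z) - q (q y x) z)
    (h1 : ∀ x y z, q x (c y z) + c x (q y z) - (q (c x y) z + c (q x y) z) =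
      q y (c x z) + c y (q x z) - (q (c y x) z + c (q y x) z))
    (h2 : ∀ x y z, c x (c y z) - c (c x y) z = c y (c x z) - c (c y x) z) :
    IsLeftPreLie (seriesMul (firstOrder q c)) := by
  intro u v w
  set m := seriesMul (firstOrder q c) with hm
  refine series_ext (E := fun u => m u (m v w) - m (m u v) w)
    (F := fun u => m v (m u w) - m (m v u) w)
    (fun _ _ => by simp only [hm, seriesMul_add_left]; abel)
    (fun _ _ => by simp only [hm, seriesMul_add_left, seriesMul_add_right]; abel)
    (by simp [hm, seriesMul_shift_left, seriesShift_sub])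
    (by simp [hm, seriesMul_shift_left, seriesMul_shift_right, seriesShift_sub]) (fun x => ?_) u
  refine series_ext (E := fun v => m (Pi.single 0 x) (m v w) - m (m (Pi.single 0 x) v) w)
    (F := fun v => m v (m (Pi.single 0 x) w) - m (m v (Pi.single 0 x)) w)
    (fun _ _ => by simp only [hm, seriesMul_add_left, seriesMul_add_right]; abel)
    (fun _ _ => by simp only [hm, seriesMul_add_left]; abel)
    (by simp [hm, seriesMul_shift_left, seriesMul_shift_right, seriesShift_sub])
    (by simp [hm, seriesMul_shift_left, seriesShift_sub]) (fun y => ?_) v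
  refine series_ext
    (E := fun w => m (Pi.single 0 x) (m (Pi.single 0 y) w) - m (m (Pi.single 0 x) (Pi.single 0 y)) w)
    (F := fun w => m (Pi.single 0 y) (m (Pi.single 0 x) w) - m (m (Pi.single 0 y) (Pi.single 0 x)) w)
    (fun _ _ => by simp only [hm, seriesMul_add_right]; abel)
    (fun _ _ => by simp only [hm, seriesMul_add_right]; abel)
    (by simp [hm, seriesMul_shift_right, seriesShift_sub])
    (by simp [hm, seriesMul_shift_right, seriesShift_sub]) (fun z => ?_) w
  have hr : ∀ x y z : V, m (Pi.single 0 x) (m (Pi.single 0 y) (Pi.single 0 z)) =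
      Pi.single 0 (q x (q y z)) + seriesShift (Pi.single 0 (q x (c y z) + c x (q y z)) +
        seriesShift (Pi.single 0 (c x (c y z)))) := fun x y z => by
    simp only [hm, seriesMul_firstOrder_single, seriesMul_add_right, seriesMul_shift_right,
      seriesShift_add, Pi.single_add]
    abel
  have hl : ∀ x y z : V, m (m (Pi.single 0 x) (Pi.single 0 y)) (Pi.single 0 z) =
      Pi.single 0 (q (q x y) z) + seriesShift (Pi.single 0 (q (c x y) z + c (q x y) z) +
        seriesShift (Pi.single 0 (c (c x y) z))) := fun x y z => by
    simp only [hm, seriesMul_firstOrder_single, seriesMul_add_left, seriesMul_shift_left,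
      seriesShift_add, Pi.single_add]
    abel
  simp only [hr, hl]
  ext k
  rcases k with _ | _ | _ | k
  · simpa [seriesShift] using h0 x y z
  · simpa [seriesShift] using h1 x y z
  · simpa [seriesShift] using h2 x y z
  · simp [seriesShift]

/-- The first coefficient of a trivial deformation is a coboundary. -/
theorem mem_range_coboundaryOne_of_isTrivialDeformation
    (h : IsTrivialDeformation q (firstOrder q c)) : c ∈ LinearMap.range (coboundaryOne q) := by
  obtain ⟨b, hb, h⟩ := h
  refine ⟨-b 1, ?_⟩
  ext x y
  -- The coefficient of `t` reads `c(x, y) + q(b₁ x, y) + q(x, b₁ y) = b₁ q(x, y)`, whence the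
  -- primitive `-b₁`.
  have := congrFun (h (Pi.single 0 x) (Pi.single 0 y)) 1
  simp only [seriesMap_single, seriesMul_single_single] at this
  have h1 : Finset.HasAntidiagonal.antidiagonal 1 = {((0 : ℕ), (1 : ℕ)), (1, 0)} := rfl
  simp [seriesMul, seriesMap, firstOrder, h1, hb] at this
  simp only [coboundaryOne, LinearMap.coe_mk, AddHom.coe_mk, LinearMap.mk₂_apply,
    LinearMap.neg_apply, map_neg]
  rw [← this]
  abel

end FirstOrder

/-! ### The trace cocycles and non-rigidity in the pre-Lie case. -/

section MatrixPreLie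

variable {K : Type*} [Field K] {n : ℕ}

lemma traceCochain_apply (a x y : Matrix (Fin n) (Fin n) K) :
    traceCochain a x y = ((1 / (n : K)) * x.trace) • (y * a - a * y) := rfl

lemma matMul_apply (x y : Matrix (Fin n) (Fin n) K) : matMul K n x y = x * y := rfl

lemma mem_preLieZ2_iff {V : Type*} [AddCommGroup V] [Module K V] {q c : V →ₗ[K] V →ₗ[K] V} :
    c ∈ preLieZ2 q ↔ ∀ x y z, q x (c y z) + c x (q y z) - (q (c x y) z + c (q x y) z) =
      q y (c x z) + c y (q x z) - (q (c y x) z + c (q y x) z) := by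
  simp only [preLieZ2, LinearMap.mem_ker, LinearMap.ext_iff]
  refine forall_congr' fun x => forall_congr' fun y => forall_congr' fun z => ?_
  rw [← sub_eq_zero (a := _ - _)]
  simp only [preLieTwo, LinearMap.coe_mk, AddHom.coe_mk, LinearMap.mk₂_apply,
    LinearMap.zero_apply, map_sub, LinearMap.sub_apply]
  refine Eq.congr ?_ rfl
  abel

/-- As `[·, a]` is a derivation, the left side is `(1/n)(tr(y) x + tr(x) y - tr(xy))[z, a]`,
symmetric in `x` and `y`. -/
lemma traceCochain_cocycle (a x y z : Matrix (Fin n) (Fin n) K) :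
    matMul K n x (traceCochain a y z) + traceCochain a x (matMul K n y z)
        - (matMul K n (traceCochain a x y) z + traceCochain a (matMul K n x y) z) =
      matMul K n y (traceCochain a x z) + traceCochain a y (matMul K n x z)
        - (matMul K n (traceCochain a y x) z + traceCochain a (matMul K n y x) z) := by
  simp only [traceCochain_apply, matMul_apply, Matrix.trace_mul_comm y x, Matrix.mul_smul,
    Matrix.smul_mul, mul_sub, sub_mul, mul_assoc]
  module

lemma isFormalDeformation_traceCochain (a : Matrix (Fin n) (Fin n) K) :
    IsFormalDeformation IsLeftPreLie (matMul K n) (firstOrder (matMul K n) (traceCochain a)) := by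
  refine ⟨by simp [firstOrder], isLeftPreLie_seriesMul_firstOrder (fun x y z => ?_)
    (traceCochain_cocycle a) (fun x y z => ?_)⟩
  · simp [matMul_apply, mul_assoc]
  -- At order 2, `c_a(c_a(x, y), z)` vanishes since commutators are traceless, and `c_a(x, c_a(y,
  -- z))` is `tr(x) tr(y) / n²` times `[[z, a], a]`.
  · have htr : ∀ x y, (traceCochain a x y).trace = 0 := fun x y => by
      rw [traceCochain_apply, Matrix.trace_smul, Matrix.trace_sub, Matrix.trace_mul_comm, sub_self,
        smul_zero]
    have h0 : ∀ x y z, traceCochain a (traceCochain a x y) z = 0 := fun x y z => by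
      rw [traceCochain_apply, htr, mul_zero, zero_smul]
    rw [h0, h0]
    simp only [traceCochain_apply, Matrix.mul_smul, Matrix.smul_mul, ← smul_sub, smul_smul]
    rw [mul_comm]

lemma traceCochain_notMem_preLieB2 [CharZero K] (hn : n ≠ 0) {a : Matrix (Fin n) (Fin n) K}
    (ha : a ∉ Set.range (Matrix.scalar (Fin n))) : traceCochain a ∉ preLieB2 (matMul K n) := by
  rintro ⟨f, hf⟩
  have hn : (n : K) ≠ 0 := Nat.cast_ne_zero.mpr hn
  -- At `x = 1` the coboundary of `f` collapses to `f(1) y`, while `tr(1)/n = 1`. Then `y = 1`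
  -- forces `f(1) = 0`, so `a` would be central.
  have h : ∀ y, f 1 * y = y * a - a * y := fun y => by
    have := LinearMap.congr_fun (LinearMap.congr_fun hf 1) y
    simpa [coboundaryOne, matMul_apply, traceCochain_apply, hn] using this
  have h1 : f 1 = 0 := by simpa using h 1
  refine ha (Matrix.mem_range_scalar_iff_commute_single'.mpr fun i j => ?_)
  have := h (Matrix.single i j 1)
  rw [h1, zero_mul] at this
  exact (sub_eq_zero.mp this.symm)

lemma single_notMem_range_scalar (hn : 2 ≤ n) :
    (Matrix.single ⟨0, by omega⟩ ⟨1, by omega⟩ 1 : Matrix (Fin n) (Fin n) K) ∉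
      Set.range (Matrix.scalar (Fin n)) := by
  rintro ⟨r, hr⟩
  have := congrFun (congrFun hr ⟨0, by omega⟩) ⟨1, by omega⟩
  simp [Matrix.scalar_apply] at this

lemma subsingleton_hochschildH2_matMul : Subsingleton (HochschildH2 (matMul K n)) := by
  refine Submodule.Quotient.subsingleton_iff.mpr (eq_top_iff.mpr ?_)
  rintro ⟨c, hc⟩ -
  obtain ⟨f, rfl⟩ := exists_eq_coboundaryOne_of_hochschildTwo_eq_zero c hc
  exact ⟨f, rfl⟩

lemma subsingleton_chevalleyH2_matrix [CharZero K] :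
    Subsingleton (ChevalleyH2 K (Matrix (Fin n) (Fin n) K)) := by
  refine Submodule.Quotient.subsingleton_iff.mpr (eq_top_iff.mpr ?_)
  rintro ⟨c, hc⟩ -
  have hbr : ∀ x y, matBracket K n x y = ⁅x, y⁆ := fun _ _ => rfl
  obtain ⟨f, hf⟩ := exists_eq_coboundaryOne_matBracket c.1 c.2 fun x y z => by
    have h := LinearMap.congr_fun (LinearMap.congr_fun (LinearMap.congr_fun
      ((LieModule.Cohomology.mem_twoCocycle_iff _ _ _ c).mp hc) x) y) z
    rw [LieModule.Cohomology.d₂₃_apply] at h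
    simp only [hbr, LieModule.Cohomology.twoCochain_val_apply]
    -- Skew-symmetry of `c` and of the bracket turns the cyclic form of the cocycle identity into
    -- the one given by `d₂₃`.
    rw [← LieModule.Cohomology.twoCochain_skew c ⁅y, z⁆ x,
      ← LieModule.Cohomology.twoCochain_skew c ⁅x, y⁆ z,
      ← LieModule.Cohomology.twoCochain_skew c x z, ← lie_skew z x, map_neg, lie_neg,
      ← LieModule.Cohomology.twoCochain_skew c ⁅x, z⁆ y, neg_neg]
    refine Eq.trans ?_ h
    abel
  refine ⟨f, Subtype.ext ?_⟩
  change (LieModule.Cohomology.d₁₂ K _ _ f).1 = c.1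
  rw [hf]
  ext1 x
  ext1 y
  rw [LieModule.Cohomology.d₁₂_apply_coe_apply_apply]
  simp only [coboundaryOne, LinearMap.coe_mk, AddHom.coe_mk, LinearMap.mk₂_apply, hbr]
  rw [← lie_skew y]
  abel

lemma nontrivial_preLieH2_matMul [CharZero K] (hn : 2 ≤ n) :
    Nontrivial (PreLieH2 (matMul K n)) := by
  refine Submodule.Quotient.nontrivial_iff.mpr fun h => ?_
  have hmem : (⟨traceCochain _, mem_preLieZ2_iff.mpr (traceCochain_cocycle
    (Matrix.single ⟨0, by omega⟩ ⟨1, by omega⟩ 1))⟩ : preLieZ2 (matMul K n)) ∈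
      (preLieB2 (matMul K n)).submoduleOf (preLieZ2 (matMul K n)) := h ▸ Submodule.mem_top
  exact traceCochain_notMem_preLieB2 (by omega) (single_notMem_range_scalar hn) hmem

end MatrixPreLie

theorem mainTheorem11 (K : Type*) [Field K] [CharZero K] (n : ℕ) :
    (Subsingleton (HochschildH2 (matMul K n)) ∧
      IsRigid IsAssocProduct (matMul K n)) ∧
    (Subsingleton (ChevalleyH2 K (Matrix (Fin n) (Fin n) K)) ∧
      IsRigid IsLieBracket (matBracket K n)) ∧
    (2 ≤ n →
      (∃ c, IsTrueDeformationOrderOne IsLeftPreLie (preLieB2 (matMul K n)) (matMul K n) c) ∧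
      Nontrivial (PreLieH2 (matMul K n)) ∧
      ¬ IsRigid IsLeftPreLie (matMul K n) ∧
      ∀ a : Matrix (Fin n) (Fin n) K, a ∉ Set.range (Matrix.scalar (Fin n)) →
        traceCochain a ∈ preLieZ2 (matMul K n) ∧
        traceCochain a ∉ preLieB2 (matMul K n) ∧
        IsTrueDeformationOrderOne IsLeftPreLie (preLieB2 (matMul K n)) (matMul K n)
          (traceCochain a) ∧
        ¬ IsTrivialDeformation (matMul K n) (firstOrder (matMul K n) (traceCochain a))) := by
  refine ⟨⟨subsingleton_hochschildH2_matMul,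
      isRigid_isAssocProduct exists_eq_coboundaryOne_of_hochschildTwo_eq_zero⟩,
    ⟨subsingleton_chevalleyH2_matrix,
      isRigid_isLieBracket exists_eq_coboundaryOne_matBracket⟩, fun hn => ?_⟩
  have hB (a : Matrix (Fin n) (Fin n) K) (ha : a ∉ Set.range (Matrix.scalar (Fin n))) :=
    traceCochain_notMem_preLieB2 (by omega) ha
  have htriv (a : Matrix (Fin n) (Fin n) K) (ha : a ∉ Set.range (Matrix.scalar (Fin n))) :
      ¬ IsTrivialDeformation (matMul K n) (firstOrder (matMul K n) (traceCochain a)) :=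
    fun h => hB a ha (mem_range_coboundaryOne_of_isTrivialDeformation h)
  -- The elementary matrix `e_{01}` is the non-scalar `a` used for the existence and non-rigidity
  -- claims.
  have hns := single_notMem_range_scalar (K := K) hn
  exact ⟨⟨_, isFormalDeformation_traceCochain _, hB _ hns⟩, nontrivial_preLieH2_matMul hn,
    fun h => htriv _ hns (h _ (isFormalDeformation_traceCochain _)),
    fun a ha => ⟨mem_preLieZ2_iff.mpr (traceCochain_cocycle a), hB a ha,
      ⟨isFormalDeformation_traceCochain a, hB a ha⟩, htriv a ha⟩⟩
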